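/- Let $\mathcal X\subset\mathbb C$ be a finite set and let $P_X$ be a probability distribution on $\mathcal X$ (not necessarily uniform). Let $X$ have distribution $P_X$ and let $Z$ be independent of $X$, circularly symmetric complex Gaussian of unit variance, i.e. with density $\frac1\pi e^{-|z|^2}$ on $\mathbb C$. For $\mathrm{SNR}\ge 0$ let $$C_{\mathcal X}(\mathrm{SNR})=-\,\mathbb E\Bigl[\log\sum_{x'\in\mathcal X}P_X(x')\,e^{-|\sqrt{\mathrm{SNR}}\,(X-x')+Z|^2+|Z|^2}\Bigr]$$ be the constrained capacity, that is, the mutual information (in nats) between the input $X$ and the output $Y=\sqrt{\mathrm{SNR}}\,X+Z$ of the complex Gaussian channel. Put $\mu_1=\mathbb E[X]$, $\mu_2=\mathbb E[|X|^2]$ and $\mu_2'=\mathbb E[X^2]$. Then the expectation exists (for each transmitted symbol the logarithm above is an integrable function of the noise), and, as $\mathrm{SNR}\to0$ through nonnegative values, the capacity has the expansion $$C_{\mathcal X}(\mathrm{SNR})=c_1\,\mathrm{SNR}+c_2\,\mathrm{SNR}^2+o(\mathrm{SNR}^2)$$ with the (unique) coefficients $$c_1=\mu_2-|\mu_1|^2,\qquad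 c_2=-\tfrac12\Bigl(\bigl(\mu_2-|\mu_1|^2\bigr)^2+\bigl|\mu_2'-\mu_1^2\bigr|^2\Bigr).$$ If $\mu_1=0$ and $\mu_2=1$, then $c_1=1$ and $c_2=-\tfrac12\bigl(1+|\mu_2'|^2\bigr)$, and the bit-energy-to-noise ratio at zero SNR is $\bigl(\frac{E_b}{N_0}\bigr)_{\lim}:=\frac{\log 2}{c_1}=\log 2$; it is also the limit of $\frac{E_b}{N_0}=\frac{\mathrm{SNR}}{C_{\mathcal X}(\mathrm{SNR})\,\log_2 e}$ as $\mathrm{SNR}\to0^+$. -/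

import Mathlib

open MeasureTheory Filter Topology Asymptotics

noncomputable section

namespace CodedModulation

/-- Circularly symmetric complex Gaussian noise of unit variance:
the law on `ℂ` with density `π⁻¹ * exp (-|z|^2)` with respect to Lebesgue measure. -/
def noise : Measure ℂ :=
  volume.withDensity fun z => ENNReal.ofReal (Real.pi⁻¹ * Real.exp (-‖z‖ ^ 2))

/-- The mean `E[X]` of the symbols of the constellation `S` used with probabilities `P`. -/
def mu1 (S : Finset ℂ) (P : ℂ → ℝ) : ℂ := ∑ x ∈ S, x * (P x : ℂ)

/-- The second moment `E[|X|^2]`. -/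
def mu2 (S : Finset ℂ) (P : ℂ → ℝ) : ℝ := ∑ x ∈ S, ‖x‖ ^ 2 * P x

/-- The second-order pseudo-moment `E[X^2]`. -/
def mu2' (S : Finset ℂ) (P : ℂ → ℝ) : ℂ := ∑ x ∈ S, x ^ 2 * (P x : ℂ)

/-- The random variable whose expectation is minus the constrained capacity, at transmitted
symbol `x` and noise sample `z`:
`log (∑ x', P x' * exp (-|√snr * (x - x') + z|^2 + |z|^2))`. -/
def logTerm (S : Finset ℂ) (P : ℂ → ℝ) (snr : ℝ) (x z : ℂ) : ℝ :=
  Real.log (∑ x' ∈ S,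
    P x' * Real.exp (-‖((Real.sqrt snr : ℝ) : ℂ) * (x - x') + z‖ ^ 2 + ‖z‖ ^ 2))

/-- The constrained (coded modulation) capacity, in nats per channel use, of the channel
`Y = √snr * X + Z`: the mutual information between `X` and `Y`, as an expectation over the
symbol `X` (with law `P` on `S`) and the independent noise `Z`. -/
def capacity (S : Finset ℂ) (P : ℂ → ℝ) (snr : ℝ) : ℝ :=
  -∑ x ∈ S, P x * ∫ z, logTerm S P snr x z ∂noise

/-- `C(snr) = c₁ * snr + c₂ * snr^2 + o(snr^2)` as `snr → 0`, `snr ≥ 0`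
(in particular `C(0) = 0`). -/
def HasLowSNRExpansion (C : ℝ → ℝ) (c₁ c₂ : ℝ) : Prop :=
  (fun snr : ℝ => C snr - (c₁ * snr + c₂ * snr ^ 2)) =o[𝓝[≥] (0 : ℝ)] fun snr : ℝ => snr ^ 2

/-- The bit-energy-to-noise ratio `snr / (C(snr) * log₂ e)`, with `C` in nats. -/
def ebN0 (C : ℝ → ℝ) (snr : ℝ) : ℝ := snr / (C snr * Real.logb 2 (Real.exp 1))

/-- `L` is the limiting bit-energy-to-noise ratio `log 2 / c₁`, where `c₁ ≠ 0` is the first-order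
coefficient of the low-SNR expansion of `C`. -/
def IsEbN0Lim (C : ℝ → ℝ) (L : ℝ) : Prop :=
  ∃ c₁ c₂ : ℝ, HasLowSNRExpansion C c₁ c₂ ∧ c₁ ≠ 0 ∧ L = Real.log 2 / c₁

end CodedModulation

end

/-! Put `t = √snr` and let `v x = x - μ₁` be the centred symbols. Relative to the noise law, the
centred output has density `L`, the `P`-mixture of the Gaussian likelihood ratios `tilt (t • v x)`.
Then the capacity is `t² ∑ P ‖v‖² - ∫ L log L`, the mean divergence of the translated noises minus
that of their mixture (`capacity_eq`). The first term is exactly `c₁ * snr`.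

Centring kills the linear term of `L - 1`, so `L - 1 = O(t²)` with an exponentially growing constant
(`abs_mixture_smul_sub_one_le`). Since `L log L = (L² - 1) / 2 + O(|L - 1|³)`, the divergence is
half of `∫ L² - 1`, up to `O(t⁶)`. That integral is explicit: `∫ L² = ∑ᵢ ∑ⱼ Pᵢ Pⱼ exp (2 t² ⟨vᵢ,
vⱼ⟩)`. Its linear term again vanishes by centring, and the quadratic one leaves `t⁴ ∑ᵢ ∑ⱼ Pᵢ Pⱼ ⟨vᵢ,
vⱼ⟩²` in the divergence. `sum_sum_inner_sq` rewrites this sum through the variance and the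
pseudo-variance. The error `O(snr³)` is `o(snr²)`. -/

namespace CodedModulation

open Real (exp)

/-! ### Integration against the Gaussian noise -/

/-- The density of the noise. -/
noncomputable def noiseDensity (z : ℂ) : ℝ := Real.pi⁻¹ * exp (-‖z‖ ^ 2)

lemma noiseDensity_nonneg (z : ℂ) : 0 ≤ noiseDensity z := by
  unfold noiseDensity; positivity

lemma continuous_noiseDensity : Continuous noiseDensity := by
  unfold noiseDensity; fun_prop

lemma integral_noise (f : ℂ → ℝ) : ∫ z, f z ∂noise = ∫ z, noiseDensity z * f z := by
  have h := integral_withDensity_eq_integral_toReal_smul₀ (μ := (volume : Measure ℂ))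
    (f := fun z => ENNReal.ofReal (noiseDensity z))
    continuous_noiseDensity.measurable.ennreal_ofReal.aemeasurable
    (Eventually.of_forall fun _ => ENNReal.ofReal_lt_top) f
  refine h.trans (integral_congr_ae (Eventually.of_forall fun z => ?_))
  simp [ENNReal.toReal_ofReal (noiseDensity_nonneg z)]

lemma integrable_noise_iff (f : ℂ → ℝ) :
    Integrable f noise ↔ Integrable fun z => noiseDensity z * f z := by
  have h := integrable_withDensity_iff_integrable_smul' (μ := (volume : Measure ℂ))
    (f := fun z => ENNReal.ofReal (noiseDensity z)) (g := f)
    continuous_noiseDensity.measurable.ennreal_ofReal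
    (Eventually.of_forall fun _ => ENNReal.ofReal_lt_top)
  refine h.trans (integrable_congr (Eventually.of_forall fun z => ?_))
  simp [ENNReal.toReal_ofReal (noiseDensity_nonneg z)]

lemma integrable_exp_neg_mul_sq_norm {b : ℝ} (hb : 0 < b) :
    Integrable fun z : ℂ => exp (-b * ‖z‖ ^ 2) := by
  have h := GaussianFourier.integral_rexp_neg_mul_sq_norm (V := ℂ) hb
  -- A non-integrable function has integral `0` by convention, whereas this integral is positive.
  refine not_imp_comm.1 integral_undef ?_
  rw [h]
  positivity

lemma integral_noiseDensity : ∫ z, noiseDensity z = 1 := by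
  have h := GaussianFourier.integral_rexp_neg_mul_sq_norm (V := ℂ) one_pos
  simp only [neg_mul, one_mul, Complex.finrank_real_complex, div_one, Nat.cast_ofNat,
    div_self (two_ne_zero' ℝ), Real.rpow_one] at h
  simp only [noiseDensity, integral_const_mul, h]
  exact inv_mul_cancel₀ Real.pi_ne_zero

/-- Continuous functions on `ℂ` of at most exponential growth. -/
def HasExpGrowth (f : ℂ → ℝ) : Prop :=
  Continuous f ∧ ∃ A B : ℝ, 0 ≤ A ∧ 0 ≤ B ∧ ∀ z, |f z| ≤ A * exp (B * ‖z‖)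

namespace HasExpGrowth

variable {f g : ℂ → ℝ}

lemma of_bound (hf : Continuous f) (hg : HasExpGrowth g) (h : ∀ z, |f z| ≤ g z) :
    HasExpGrowth f := by
  obtain ⟨-, A, B, hA, hB, hgb⟩ := hg
  exact ⟨hf, A, B, hA, hB, fun z => (h z).trans ((le_abs_self _).trans (hgb z))⟩

lemma const (c : ℝ) : HasExpGrowth fun _ => c :=
  ⟨continuous_const, |c|, 0, abs_nonneg c, le_rfl, fun z => by simp⟩

lemma add (hf : HasExpGrowth f) (hg : HasExpGrowth g) : HasExpGrowth fun z => f z + g z := by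
  obtain ⟨hfc, A, B, hA, hB, hf⟩ := hf
  obtain ⟨hgc, A', B', hA', hB', hg⟩ := hg
  refine ⟨hfc.add hgc, A + A', B + B', by positivity, by positivity, fun z => ?_⟩
  have h1 : exp (B * ‖z‖) ≤ exp ((B + B') * ‖z‖) := by gcongr; linarith
  have h2 : exp (B' * ‖z‖) ≤ exp ((B + B') * ‖z‖) := by gcongr; linarith
  calc |f z + g z| ≤ |f z| + |g z| := abs_add_le _ _
    _ ≤ A * exp (B * ‖z‖) + A' * exp (B' * ‖z‖) := add_le_add (hf z) (hg z)
    _ ≤ A * exp ((B + B') * ‖z‖) + A' * exp ((B + B') * ‖z‖) := by gcongr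
    _ = _ := by ring

lemma mul (hf : HasExpGrowth f) (hg : HasExpGrowth g) : HasExpGrowth fun z => f z * g z := by
  obtain ⟨hfc, A, B, hA, hB, hf⟩ := hf
  obtain ⟨hgc, A', B', hA', hB', hg⟩ := hg
  refine ⟨hfc.mul hgc, A * A', B + B', by positivity, by positivity, fun z => ?_⟩
  rw [abs_mul]
  calc |f z| * |g z| ≤ (A * exp (B * ‖z‖)) * (A' * exp (B' * ‖z‖)) := by
        gcongr; exacts [hf z, hg z]
    _ = _ := by rw [add_mul, Real.exp_add]; ring

lemma const_mul (c : ℝ) (hf : HasExpGrowth f) : HasExpGrowth fun z => c * f z :=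
  (const c).mul hf

lemma sub (hf : HasExpGrowth f) (hg : HasExpGrowth g) : HasExpGrowth fun z => f z - g z := by
  simpa [sub_eq_add_neg] using hf.add (hg.const_mul (-1))

lemma sum {ι : Type*} {S : Finset ι} {F : ι → ℂ → ℝ} (h : ∀ i ∈ S, HasExpGrowth (F i)) :
    HasExpGrowth fun z => ∑ i ∈ S, F i z := by
  classical
  induction S using Finset.induction_on with
  | empty => simpa using const 0
  | insert a s ha ih =>
    simp only [Finset.sum_insert ha]
    exact (h a (Finset.mem_insert_self a s)).add
      (ih fun i hi => h i (Finset.mem_insert_of_mem hi))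

lemma exp_norm (a b : ℝ) : HasExpGrowth fun z => exp (a * ‖z‖ + b) := by
  refine ⟨by fun_prop, exp b, |a|, (Real.exp_pos b).le, abs_nonneg a, fun z => ?_⟩
  rw [abs_of_pos (Real.exp_pos _), ← Real.exp_add]
  have := mul_le_mul_of_nonneg_right (le_abs_self a) (norm_nonneg z)
  exact Real.exp_le_exp.2 (by linarith)

lemma inner_left (w : ℂ) : HasExpGrowth fun z => inner ℝ w z := by
  refine of_bound (by fun_prop) (exp_norm ‖w‖ 0) fun z => ?_
  have h := Real.add_one_le_exp (‖w‖ * ‖z‖ + 0)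
  linarith [abs_real_inner_le_norm w z]

/-- Half of the Gaussian decay absorbs the growth, as `B‖z‖ ≤ B² / 2 + ‖z‖² / 2`. -/
lemma integrable (hf : HasExpGrowth f) : Integrable f noise := by
  obtain ⟨hfc, A, B, hA, hB, hf⟩ := hf
  rw [integrable_noise_iff]
  refine ((integrable_exp_neg_mul_sq_norm (one_half_pos (α := ℝ))).const_mul
    (Real.pi⁻¹ * A * exp (B ^ 2 / 2))).mono'
    (continuous_noiseDensity.mul hfc).aestronglyMeasurable (Eventually.of_forall fun z => ?_)
  rw [Real.norm_eq_abs, abs_mul, abs_of_nonneg (noiseDensity_nonneg z), noiseDensity]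
  calc Real.pi⁻¹ * exp (-‖z‖ ^ 2) * |f z|
      ≤ Real.pi⁻¹ * exp (-‖z‖ ^ 2) * (A * exp (B * ‖z‖)) := by gcongr; exact hf z
    _ = Real.pi⁻¹ * A * exp (-‖z‖ ^ 2 + B * ‖z‖) := by rw [Real.exp_add]; ring
    _ ≤ Real.pi⁻¹ * A * exp (B ^ 2 / 2 + -(1 / 2) * ‖z‖ ^ 2) := by
        refine mul_le_mul_of_nonneg_left (Real.exp_le_exp.2 ?_) (by positivity)
        nlinarith [sq_nonneg (B - ‖z‖)]
    _ = _ := by rw [Real.exp_add]; ring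

end HasExpGrowth

/-- The likelihood ratio at `y` between the Gaussian noise translated by `w` and the noise. -/
noncomputable def tilt (w y : ℂ) : ℝ := exp (2 * inner ℝ w y - ‖w‖ ^ 2)

lemma tilt_pos (w y : ℂ) : 0 < tilt w y := Real.exp_pos _

lemma tilt_le (w y : ℂ) : tilt w y ≤ exp (2 * ‖w‖ * ‖y‖ + 0) := by
  unfold tilt
  gcongr
  nlinarith [real_inner_le_norm w y, sq_nonneg ‖w‖]

lemma hasExpGrowth_tilt (w : ℂ) : HasExpGrowth (tilt w) := by
  refine .of_bound (by unfold tilt; fun_prop) (.exp_norm (2 * ‖w‖) 0) fun y => ?_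
  rw [abs_of_pos (tilt_pos w y)]
  exact tilt_le w y

lemma noiseDensity_sub (w y : ℂ) : noiseDensity (y - w) = noiseDensity y * tilt w y := by
  rw [noiseDensity, noiseDensity, tilt, mul_assoc, ← Real.exp_add, norm_sub_sq_real,
    real_inner_comm]
  ring_nf

/-- Change of variables for translations. -/
lemma integral_noise_add (w : ℂ) (f : ℂ → ℝ) :
    ∫ z, f (z + w) ∂noise = ∫ y, tilt w y * f y ∂noise := by
  rw [integral_noise, integral_noise,
    ← integral_sub_right_eq_self (fun z => noiseDensity z * f (z + w)) w]
  simp only [sub_add_cancel, noiseDensity_sub, mul_assoc]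

lemma integral_noise_const (c : ℝ) : ∫ _, c ∂noise = c := by
  rw [integral_noise, integral_mul_const, integral_noiseDensity, one_mul]

lemma integral_tilt (w : ℂ) : ∫ y, tilt w y ∂noise = 1 := by
  simpa only [integral_noise_const, mul_one] using (integral_noise_add w fun _ => 1).symm

lemma tilt_mul_tilt (w w' y : ℂ) :
    tilt w y * tilt w' y = exp (2 * inner ℝ w w') * tilt (w + w') y := by
  rw [tilt, tilt, tilt, ← Real.exp_add, ← Real.exp_add, norm_add_sq_real, inner_add_left]
  ring_nf

lemma integral_tilt_mul_tilt (w w' : ℂ) :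
    ∫ y, tilt w y * tilt w' y ∂noise = exp (2 * inner ℝ w w') := by
  simp only [tilt_mul_tilt, integral_const_mul, integral_tilt, mul_one]

lemma integral_noise_inner (w : ℂ) : ∫ z, inner ℝ w z ∂noise = 0 := by
  -- The integrand is odd, so reflecting `z` equates the integral with its negative.
  have h := integral_neg_eq_self (fun z => noiseDensity z * inner ℝ w z) volume
  simp only [noiseDensity, norm_neg, inner_neg_right, mul_neg, integral_neg] at h
  rw [integral_noise]
  simp only [noiseDensity]
  linarith

/-! ### Real estimates -/

lemma abs_exp_sub_sum_le (x : ℝ) (n : ℕ) :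
    |exp x - ∑ m ∈ Finset.range n, x ^ m / m.factorial| ≤ |x| ^ n * exp |x| := by
  have h := Complex.norm_exp_sub_sum_le_norm_mul_exp (x : ℂ) n
  rw [Complex.norm_real, Real.norm_eq_abs] at h
  rw [← Real.norm_eq_abs, ← Complex.norm_real]
  push_cast
  exact h

lemma abs_mul_log_le {x : ℝ} (hx : 0 < x) : |x * Real.log x| ≤ 1 + x ^ 2 := by
  have h1 := Real.log_le_sub_one_of_pos hx
  have h2 := Real.one_sub_inv_le_log_of_pos hx
  have h3 : x - 1 ≤ x * Real.log x := by
    have := mul_le_mul_of_nonneg_left h2 hx.le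
    rwa [mul_sub, mul_one, mul_inv_cancel₀ hx.ne'] at this
  rw [abs_le]
  constructor <;> nlinarith [mul_le_mul_of_nonneg_left h1 hx.le]

/-- For `u = x - 1` small this is the Taylor expansion of `log (1 + u)`. For `|u| > 1 / 2` each
term, bounded crudely by `abs_mul_log_le`, is dominated by `|u|³`. The constant `40` is not sharp.
-/
lemma abs_mul_log_sub_le {x : ℝ} (hx : 0 < x) :
    |x * Real.log x - (x - 1) - (x - 1) ^ 2 / 2| ≤ 40 * |x - 1| ^ 3 := by
  obtain ⟨u, rfl⟩ : ∃ u, x = 1 + u := ⟨x - 1, by ring⟩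
  simp only [add_sub_cancel_left]
  rcases le_or_gt |u| (1 / 2) with hu | hu
  · have h := Real.abs_log_sub_add_sum_range_le (x := -u) (by rw [abs_neg]; linarith) 2
    simp only [Finset.sum_range_succ, Finset.sum_range_zero, abs_neg, sub_neg_eq_add] at h
    have h2 : |u| ^ (2 + 1) / (1 - |u|) ≤ 2 * |u| ^ 3 := by
      rw [div_le_iff₀ (by linarith)]
      calc |u| ^ 3 = |u| ^ 3 * 1 := (mul_one _).symm
        _ ≤ |u| ^ 3 * (2 * (1 - |u|)) := by gcongr; linarith
        _ = _ := by ring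
    have h3 := h.trans h2
    norm_num at h3
    have key : (1 + u) * Real.log (1 + u) - u - u ^ 2 / 2 =
        (1 + u) * (-u + u ^ 2 / 2 + Real.log (1 + u)) - u ^ 3 / 2 := by ring
    rw [key]
    have h4 : |1 + u| ≤ 3 / 2 := by
      rw [abs_le] at hu ⊢; constructor <;> linarith
    calc _ ≤ |(1 + u) * (-u + u ^ 2 / 2 + Real.log (1 + u))| + |u ^ 3 / 2| := abs_sub _ _
      _ = |1 + u| * |-u + u ^ 2 / 2 + Real.log (1 + u)| + |u| ^ 3 / 2 := by
          rw [abs_mul, abs_div, abs_pow, abs_two]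
      _ ≤ 3 / 2 * (2 * |u| ^ 3) + |u| ^ 3 / 2 := by gcongr
      _ ≤ _ := by nlinarith [pow_nonneg (abs_nonneg u) 3]
  · have h1 := abs_le.1 (abs_mul_log_le hx)
    have hq : |u| ^ 2 = u ^ 2 := sq_abs u
    have a1 : |u| ^ 2 ≤ 2 * |u| ^ 3 := by nlinarith [sq_nonneg |u|]
    have a2 : |u| ≤ 2 * |u| ^ 2 := by nlinarith
    have h5 := neg_abs_le u
    have h6 := le_abs_self u
    rw [abs_le]
    constructor <;> nlinarith
/-! ### Mixtures of translated Gaussians -/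

/-- The likelihood ratio between the mixture with weights `P` of the noise translated by the `v i`,
and the noise. -/
noncomputable def mixture {ι : Type*} (S : Finset ι) (P : ι → ℝ) (v : ι → ℂ) (y : ℂ) : ℝ :=
  ∑ i ∈ S, P i * tilt (v i) y

section Mixture

variable {ι : Type*} {S : Finset ι} {P : ι → ℝ} {v : ι → ℂ} {R : ℝ}

lemma le_sum_weights {f : ι → ℝ} {a : ℝ} (hP : ∀ i ∈ S, 0 ≤ P i) (hs : ∑ i ∈ S, P i = 1)
    (h : ∀ i ∈ S, a ≤ f i) : a ≤ ∑ i ∈ S, P i * f i := by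
  calc a = ∑ i ∈ S, P i * a := by rw [← Finset.sum_mul, hs, one_mul]
    _ ≤ _ := Finset.sum_le_sum fun i hi => mul_le_mul_of_nonneg_left (h i hi) (hP i hi)

lemma sum_weights_le {f : ι → ℝ} {a : ℝ} (hP : ∀ i ∈ S, 0 ≤ P i) (hs : ∑ i ∈ S, P i = 1)
    (h : ∀ i ∈ S, f i ≤ a) : ∑ i ∈ S, P i * f i ≤ a := by
  calc _ ≤ ∑ i ∈ S, P i * a :=
        Finset.sum_le_sum fun i hi => mul_le_mul_of_nonneg_left (h i hi) (hP i hi)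
    _ = a := by rw [← Finset.sum_mul, hs, one_mul]

lemma abs_sum_weights_le {f : ι → ℝ} {a : ℝ} (hP : ∀ i ∈ S, 0 ≤ P i) (hs : ∑ i ∈ S, P i = 1)
    (h : ∀ i ∈ S, |f i| ≤ a) : |∑ i ∈ S, P i * f i| ≤ a :=
  abs_le.2 ⟨le_sum_weights hP hs fun i hi => (abs_le.1 (h i hi)).1,
    sum_weights_le hP hs fun i hi => (abs_le.1 (h i hi)).2⟩

lemma hasExpGrowth_mixture (S : Finset ι) (P : ι → ℝ) (v : ι → ℂ) :
    HasExpGrowth (mixture S P v) :=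
  .sum fun i _ => (hasExpGrowth_tilt (v i)).const_mul (P i)

lemma exp_neg_le_mixture (hP : ∀ i ∈ S, 0 ≤ P i) (hs : ∑ i ∈ S, P i = 1)
    (hv : ∀ i ∈ S, ‖v i‖ ≤ R) (y : ℂ) : exp (-(2 * R * ‖y‖ + R ^ 2)) ≤ mixture S P v y := by
  refine le_sum_weights hP hs fun i hi => Real.exp_le_exp.2 ?_
  have h1 := (abs_le.1 (abs_real_inner_le_norm (v i) y)).1
  have h2 := mul_le_mul_of_nonneg_right (hv i hi) (norm_nonneg y)
  have h3 := pow_le_pow_left₀ (norm_nonneg _) (hv i hi) 2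
  linarith

lemma mixture_le_exp (hP : ∀ i ∈ S, 0 ≤ P i) (hs : ∑ i ∈ S, P i = 1)
    (hv : ∀ i ∈ S, ‖v i‖ ≤ R) (y : ℂ) : mixture S P v y ≤ exp (2 * R * ‖y‖ + R ^ 2) := by
  refine sum_weights_le hP hs fun i hi => Real.exp_le_exp.2 ?_
  have h1 := real_inner_le_norm (v i) y
  have h2 := mul_le_mul_of_nonneg_right (hv i hi) (norm_nonneg y)
  nlinarith [sq_nonneg ‖v i‖, sq_nonneg R]

lemma exists_norm_le (S : Finset ι) (v : ι → ℂ) : ∃ R : ℝ, 0 ≤ R ∧ ∀ i ∈ S, ‖v i‖ ≤ R :=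
  ⟨∑ i ∈ S, ‖v i‖, Finset.sum_nonneg fun _ _ => norm_nonneg _, fun _ hi =>
    Finset.single_le_sum (f := fun i => ‖v i‖) (fun _ _ => norm_nonneg _) hi⟩

lemma mixture_pos (hP : ∀ i ∈ S, 0 ≤ P i) (hs : ∑ i ∈ S, P i = 1) (y : ℂ) :
    0 < mixture S P v y := by
  obtain ⟨R, -, hR⟩ := exists_norm_le S v
  exact (Real.exp_pos _).trans_le (exp_neg_le_mixture hP hs hR y)

/-- The mixture lies between `exp (-b)` and `exp b` with `b = 2R‖y‖ + R²`, so its logarithm is at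
most `b ≤ exp b` in absolute value. -/
lemma hasExpGrowth_log_mixture (hP : ∀ i ∈ S, 0 ≤ P i) (hs : ∑ i ∈ S, P i = 1) :
    HasExpGrowth fun y => Real.log (mixture S P v y) := by
  obtain ⟨R, -, hR⟩ := exists_norm_le S v
  refine .of_bound ((hasExpGrowth_mixture S P v).1.log fun y => (mixture_pos hP hs y).ne')
    (.exp_norm (2 * R) (R ^ 2)) fun y => ?_
  have h0 := mixture_pos (v := v) hP hs y
  have h1 := (Real.le_log_iff_exp_le h0).2 (exp_neg_le_mixture hP hs hR y)
  have h2 := (Real.log_le_iff_le_exp h0).2 (mixture_le_exp hP hs hR y)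
  exact (abs_le.2 ⟨h1, h2⟩).trans (by linarith [Real.add_one_le_exp (2 * R * ‖y‖ + R ^ 2)])

lemma integral_mixture_sq :
    ∫ y, mixture S P v y ^ 2 ∂noise =
      ∑ i ∈ S, P i * ∑ j ∈ S, P j * exp (2 * inner ℝ (v i) (v j)) := by
  have hg (i j : ι) : Integrable (fun y => P j * (tilt (v i) y * tilt (v j) y)) noise :=
    (((hasExpGrowth_tilt (v i)).mul (hasExpGrowth_tilt (v j))).const_mul (P j)).integrable
  have h (y : ℂ) : mixture S P v y ^ 2 =
      ∑ i ∈ S, P i * ∑ j ∈ S, P j * (tilt (v i) y * tilt (v j) y) := by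
    rw [sq, mixture, Finset.sum_mul_sum]
    refine Finset.sum_congr rfl fun i _ => ?_
    rw [Finset.mul_sum]
    exact Finset.sum_congr rfl fun j _ => by ring
  simp only [h]
  rw [integral_finsetSum _ fun i _ => (integrable_finsetSum _ fun j _ => hg i j).const_mul (P i)]
  refine Finset.sum_congr rfl fun i _ => ?_
  rw [integral_const_mul, integral_finsetSum _ fun j _ => hg i j]
  simp only [integral_const_mul, integral_tilt_mul_tilt]

lemma sum_inner_eq_zero (h0 : ∑ i ∈ S, P i • v i = 0) (y : ℂ) :
    ∑ i ∈ S, P i * inner ℝ (v i) y = 0 := by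
  rw [← inner_zero_left (𝕜 := ℝ) y, ← h0, sum_inner]
  simp only [real_inner_smul_left]

/-- For centred symbols the likelihood ratio deviates from `1` only to second order. -/
lemma abs_mixture_smul_sub_one_le (hP : ∀ i ∈ S, 0 ≤ P i) (hs : ∑ i ∈ S, P i = 1)
    (h0 : ∑ i ∈ S, P i • v i = 0) (hR : 0 ≤ R) (hv : ∀ i ∈ S, ‖v i‖ ≤ R) {t : ℝ} (ht0 : 0 ≤ t)
    (ht1 : t ≤ 1) (y : ℂ) :
    |mixture S P (fun i => t • v i) y - 1| ≤ 3 * t ^ 2 * exp (2 * (2 * R * ‖y‖ + R ^ 2)) := by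
  obtain ⟨b, hb⟩ : ∃ b, b = 2 * R * ‖y‖ + R ^ 2 := ⟨_, rfl⟩
  rw [← hb]
  have hb0 : 0 ≤ b := by rw [hb]; positivity
  let a (i : ι) : ℝ := 2 * inner ℝ (t • v i) y - ‖t • v i‖ ^ 2
  have ha (i : ι) : a i = 2 * t * inner ℝ (v i) y - t ^ 2 * ‖v i‖ ^ 2 := by
    simp only [a, real_inner_smul_left, norm_smul, Real.norm_eq_abs, mul_pow, sq_abs]
    ring
  have hv2 (i : ι) (hi : i ∈ S) : ‖v i‖ ^ 2 ≤ R ^ 2 := pow_le_pow_left₀ (norm_nonneg _) (hv i hi) 2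
  have hab (i : ι) (hi : i ∈ S) : |a i| ≤ t * b := by
    have h1 := abs_real_inner_le_norm (v i) y
    have h2 := mul_le_mul_of_nonneg_right (hv i hi) (norm_nonneg y)
    have h3 : t ^ 2 * ‖v i‖ ^ 2 ≤ t * R ^ 2 := by
      have := hv2 i hi
      gcongr
      nlinarith
    rw [ha]
    calc _ ≤ |2 * t * inner ℝ (v i) y| + |t ^ 2 * ‖v i‖ ^ 2| := abs_sub _ _
      _ = 2 * t * |inner ℝ (v i) y| + t ^ 2 * ‖v i‖ ^ 2 := by
          rw [abs_mul, abs_of_nonneg (by positivity : 0 ≤ 2 * t),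
            abs_of_nonneg (by positivity : 0 ≤ t ^ 2 * ‖v i‖ ^ 2)]
      _ ≤ 2 * t * (R * ‖y‖) + t * R ^ 2 := by gcongr; exact h1.trans h2
      _ = t * b := by rw [hb]; ring
  -- The part of `a i` linear in `t` averages to zero by `h0`. What remains is the second-order
  -- remainder of `exp` and an explicit `t²` term.
  have hsplit : mixture S P (fun i => t • v i) y - 1 =
      ∑ i ∈ S, P i * (exp (a i) - 1 - a i) + t ^ 2 * ∑ i ∈ S, P i * -‖v i‖ ^ 2 := by
    have h1 : ∑ i ∈ S, P i * a i =
        2 * t * ∑ i ∈ S, P i * inner ℝ (v i) y + t ^ 2 * ∑ i ∈ S, P i * -‖v i‖ ^ 2 := by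
      rw [Finset.mul_sum, Finset.mul_sum, ← Finset.sum_add_distrib]
      exact Finset.sum_congr rfl fun i _ => by rw [ha]; ring
    rw [sum_inner_eq_zero h0, mul_zero, zero_add] at h1
    simp only [mul_sub, Finset.sum_sub_distrib, mul_one, hs, h1]
    simp only [mixture, tilt, a]
    ring
  have hexp : b ^ 2 * exp b ≤ 2 * exp (2 * b) := by
    have := Real.quadratic_le_exp_of_nonneg hb0
    rw [two_mul b, Real.exp_add]
    nlinarith [Real.exp_pos b]
  have hA : |∑ i ∈ S, P i * (exp (a i) - 1 - a i)| ≤ t ^ 2 * (2 * exp (2 * b)) := by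
    refine abs_sum_weights_le hP hs fun i hi => ?_
    have h := abs_exp_sub_sum_le (a i) 2
    norm_num [Finset.sum_range_succ] at h
    have htb : t * b ≤ b := mul_le_of_le_one_left hb0 ht1
    calc |exp (a i) - 1 - a i| = |exp (a i) - (1 + a i)| := by ring_nf
      _ ≤ |a i| ^ 2 * exp |a i| := by rw [sq_abs]; exact h
      _ ≤ (t * b) ^ 2 * exp b := by
          have := hab i hi
          have := this.trans htb
          gcongr
      _ = t ^ 2 * (b ^ 2 * exp b) := by ring
      _ ≤ _ := by gcongr
  have hB : |∑ i ∈ S, P i * -‖v i‖ ^ 2| ≤ exp (2 * b) := by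
    refine abs_sum_weights_le hP hs fun i hi => ?_
    rw [abs_neg, abs_of_nonneg (by positivity)]
    have : R ^ 2 ≤ b := by rw [hb]; nlinarith [norm_nonneg y, mul_nonneg hR (norm_nonneg y)]
    linarith [hv2 i hi, Real.add_one_le_exp (2 * b)]
  rw [hsplit]
  calc _ ≤ |∑ i ∈ S, P i * (exp (a i) - 1 - a i)| + |t ^ 2 * ∑ i ∈ S, P i * -‖v i‖ ^ 2| :=
        abs_add_le _ _
    _ ≤ t ^ 2 * (2 * exp (2 * b)) + t ^ 2 * exp (2 * b) := by
        rw [abs_mul (t ^ 2), abs_of_nonneg (sq_nonneg t)]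
        gcongr
    _ = _ := by ring

/-- The divergence of the mixture from the noise, up to third order in the squared amplitude. -/
lemma exists_abs_integral_mixture_mul_log_sub_le (hP : ∀ i ∈ S, 0 ≤ P i)
    (hs : ∑ i ∈ S, P i = 1) (h0 : ∑ i ∈ S, P i • v i = 0) :
    ∃ K : ℝ, ∀ t : ℝ, 0 ≤ t → t ≤ 1 →
      |∫ y, mixture S P (fun i => t • v i) y * Real.log (mixture S P (fun i => t • v i) y) ∂noise -
        t ^ 4 * ∑ i ∈ S, P i * ∑ j ∈ S, P j * inner ℝ (v i) (v j) ^ 2| ≤ K * t ^ 6 := by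
  obtain ⟨R, hR, hv⟩ := exists_norm_le S v
  -- `B` is the cube of the exponential in `abs_mixture_smul_sub_one_le`; below, `1080 = 40 * 3 ^
  -- 3`.
  set B : ℂ → ℝ := fun y => exp (12 * R * ‖y‖ + 6 * R ^ 2) with hB
  have hBi : Integrable B noise := (HasExpGrowth.exp_norm _ _).integrable
  refine ⟨1080 * ∫ y, B y ∂noise + 4 * (R ^ 6 * exp (2 * R ^ 2)), fun t ht0 ht1 => ?_⟩
  set L := mixture S P (fun i => t • v i) with hL
  have hLg : HasExpGrowth L := hasExpGrowth_mixture _ _ _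
  have hLL : Integrable (fun y => L y * Real.log (L y)) noise :=
    (hLg.mul (hasExpGrowth_log_mixture hP hs)).integrable
  have hL2 : Integrable (fun y => L y ^ 2) noise := by
    simpa only [sq] using (hLg.mul hLg).integrable
  have hc (c : ℝ) : Integrable (fun _ => c) noise := (HasExpGrowth.const c).integrable
  have hrem : ∫ y, (L y * Real.log (L y) - (L y - 1) - (L y - 1) ^ 2 / 2) ∂noise =
      ∫ y, L y * Real.log (L y) ∂noise - (1 / 2) * (∫ y, L y ^ 2 ∂noise - 1) := by
    -- The quadratic Taylor polynomial of `x log x` at `1` is exactly `(x² - 1) / 2`, so only the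
    -- second moment of `L` is needed.
    have h (y : ℂ) : L y * Real.log (L y) - (L y - 1) - (L y - 1) ^ 2 / 2 =
        L y * Real.log (L y) - (1 / 2) * (L y ^ 2 - 1) := by ring
    have hd : Integrable (fun y => 1 / 2 * (L y ^ 2 - 1)) noise := (hL2.sub (hc 1)).const_mul _
    simp only [h]
    rw [integral_sub hLL (hd), integral_const_mul,
      integral_sub hL2 (hc 1), integral_noise_const]
  have hbound : |∫ y, (L y * Real.log (L y) - (L y - 1) - (L y - 1) ^ 2 / 2) ∂noise| ≤
      1080 * t ^ 6 * ∫ y, B y ∂noise := by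
    rw [← Real.norm_eq_abs, ← integral_const_mul]
    refine norm_integral_le_of_norm_le (hBi.const_mul _) (Eventually.of_forall fun y => ?_)
    rw [Real.norm_eq_abs]
    refine (abs_mul_log_sub_le (mixture_pos hP hs y)).trans ?_
    have h := abs_mixture_smul_sub_one_le hP hs h0 hR hv ht0 ht1 y
    calc 40 * |L y - 1| ^ 3 ≤ 40 * (3 * t ^ 2 * exp (2 * (2 * R * ‖y‖ + R ^ 2))) ^ 3 := by gcongr
      _ = 1080 * t ^ 6 * exp (2 * (2 * R * ‖y‖ + R ^ 2)) ^ 3 := by ring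
      _ = 1080 * t ^ 6 * B y := by
          rw [hB, ← Real.exp_nat_mul]
          push_cast
          ring_nf
  have hsq : |(∫ y, L y ^ 2 ∂noise - 1) -
      2 * t ^ 4 * ∑ i ∈ S, P i * ∑ j ∈ S, P j * inner ℝ (v i) (v j) ^ 2| ≤
      8 * t ^ 6 * (R ^ 6 * exp (2 * R ^ 2)) := by
    -- The constant terms sum to `1` and the linear ones to `0` by centring, so the whole difference
    -- is an average of third-order remainders of `exp`.
    have hsplit : (∫ y, L y ^ 2 ∂noise - 1) -
        2 * t ^ 4 * ∑ i ∈ S, P i * ∑ j ∈ S, P j * inner ℝ (v i) (v j) ^ 2 =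
        ∑ i ∈ S, P i * ∑ j ∈ S, P j * (exp (2 * t ^ 2 * inner ℝ (v i) (v j)) -
          (1 + 2 * t ^ 2 * inner ℝ (v i) (v j) + (2 * t ^ 2 * inner ℝ (v i) (v j)) ^ 2 / 2)) := by
      have hgen (f g h : ι → ℝ) (c d : ℝ) : ∑ i ∈ S, P i * (f i - 1 - c * g i - d * h i) =
          ∑ i ∈ S, P i * f i - 1 - c * ∑ i ∈ S, P i * g i - d * ∑ i ∈ S, P i * h i := by
        nth_rewrite 2 [← hs]
        rw [Finset.mul_sum, Finset.mul_sum, ← Finset.sum_sub_distrib, ← Finset.sum_sub_distrib,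
          ← Finset.sum_sub_distrib]
        exact Finset.sum_congr rfl fun i _ => by ring
      have hin : ∑ i ∈ S, P i * ∑ j ∈ S, P j * inner ℝ (v i) (v j) = 0 := by
        refine Finset.sum_eq_zero fun i _ => ?_
        have h : ∑ j ∈ S, P j * inner ℝ (v i) (v j) = 0 := by
          simpa only [real_inner_comm (v i)] using sum_inner_eq_zero h0 (v i)
        rw [h, mul_zero]
      have hj (i : ι) : ∑ j ∈ S, P j * (exp (2 * t ^ 2 * inner ℝ (v i) (v j)) -
          (1 + 2 * t ^ 2 * inner ℝ (v i) (v j) + (2 * t ^ 2 * inner ℝ (v i) (v j)) ^ 2 / 2)) =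
          ∑ j ∈ S, P j * exp (2 * t ^ 2 * inner ℝ (v i) (v j)) - 1 -
            2 * t ^ 2 * ∑ j ∈ S, P j * inner ℝ (v i) (v j) -
            2 * t ^ 4 * ∑ j ∈ S, P j * inner ℝ (v i) (v j) ^ 2 := by
        rw [← hgen]
        exact Finset.sum_congr rfl fun j _ => by ring
      have hex (i j : ι) : (2 : ℝ) * inner ℝ (t • v i) (t • v j) =
          2 * t ^ 2 * inner ℝ (v i) (v j) := by
        rw [real_inner_smul_left, real_inner_smul_right]; ring
      rw [hL, integral_mixture_sq]
      simp only [hj, hex]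
      rw [hgen, hin]
      ring
    rw [hsplit]
    refine abs_sum_weights_le hP hs fun i hi => abs_sum_weights_le hP hs fun j hj => ?_
    have hr : |inner ℝ (v i) (v j)| ≤ R ^ 2 := by
      rw [sq]
      exact (abs_real_inner_le_norm _ _).trans
        (mul_le_mul (hv i hi) (hv j hj) (norm_nonneg _) hR)
    set r : ℝ := inner ℝ (v i) (v j)
    have h := abs_exp_sub_sum_le (2 * t ^ 2 * r) 3
    simp only [Finset.sum_range_succ, Finset.sum_range_zero, Nat.factorial, pow_zero, pow_one,
      zero_add, Nat.cast_one, div_one, mul_one] at h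
    norm_num at h
    have hx : 2 * t ^ 2 * |r| ≤ 2 * t ^ 2 * R ^ 2 := by gcongr
    have hx1 : 2 * t ^ 2 * |r| ≤ 2 * R ^ 2 := by
      refine hx.trans ?_
      have : t ^ 2 ≤ 1 := pow_le_one₀ ht0 ht1
      nlinarith [sq_nonneg R]
    calc _ ≤ _ := h
      _ ≤ (2 * t ^ 2 * R ^ 2) ^ 3 * exp (2 * R ^ 2) := by gcongr
      _ = _ := by ring
  rw [hrem] at hbound
  rw [abs_le] at hbound hsq ⊢
  constructor <;> nlinarith

end Mixture
/-! ### Moments of the centred constellation -/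

section Moments

variable {S : Finset ℂ} {P : ℂ → ℝ}

lemma sum_smul_centred (hs : ∑ x ∈ S, P x = 1) : ∑ x ∈ S, P x • (x - mu1 S P) = 0 := by
  simp only [smul_sub, Finset.sum_sub_distrib, ← Finset.sum_smul, hs, one_smul]
  simp [mu1, mul_comm]

lemma sum_norm_sq_centred (hs : ∑ x ∈ S, P x = 1) :
    ∑ x ∈ S, P x * ‖x - mu1 S P‖ ^ 2 = mu2 S P - ‖mu1 S P‖ ^ 2 := by
  set m := mu1 S P with hm
  have hi : ∑ x ∈ S, P x * inner ℝ x m = ‖m‖ ^ 2 := by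
    have h := sum_inner_eq_zero (sum_smul_centred hs) m
    simp only [inner_sub_left, real_inner_self_eq_norm_sq, mul_sub, Finset.sum_sub_distrib,
      ← Finset.sum_mul, hs, one_mul, ← hm] at h
    linarith
  have h (x : ℂ) : P x * ‖x - m‖ ^ 2 =
      ‖x‖ ^ 2 * P x - 2 * (P x * inner ℝ x m) + P x * ‖m‖ ^ 2 := by
    rw [norm_sub_sq_real]; ring
  simp only [h, Finset.sum_add_distrib, Finset.sum_sub_distrib, ← Finset.mul_sum, hi,
    ← Finset.sum_mul, hs, mu2]
  ring

lemma sum_sq_centred (hs : ∑ x ∈ S, P x = 1) :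
    ∑ x ∈ S, (P x : ℂ) * (x - mu1 S P) ^ 2 = mu2' S P - mu1 S P ^ 2 := by
  set m := mu1 S P with hm
  have hs' : ∑ x ∈ S, (P x : ℂ) = 1 := by exact_mod_cast hs
  have h (x : ℂ) : (P x : ℂ) * (x - m) ^ 2 =
      x ^ 2 * P x - 2 * m * (x * P x) + P x * m ^ 2 := by ring
  have hm' : ∑ x ∈ S, x * (P x : ℂ) = m := hm.symm
  simp only [h, Finset.sum_add_distrib, Finset.sum_sub_distrib, ← Finset.mul_sum, hm',
    ← Finset.sum_mul, hs', mu2']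
  ring

/-- With `u = conj w * z` this is `2 (Re u)² = |u|² + Re (u²)`. -/
lemma two_mul_inner_sq (w z : ℂ) :
    2 * (inner ℝ w z : ℝ) ^ 2 = ‖w‖ ^ 2 * ‖z‖ ^ 2 + inner ℝ (w ^ 2) (z ^ 2) := by
  rw [Complex.sq_norm, Complex.sq_norm]
  simp only [Complex.inner, Complex.normSq_apply, sq, Complex.mul_re, Complex.mul_im, Complex.conj_re, Complex.conj_im]
  ring

lemma sum_sum_inner_sq {ι : Type*} (S : Finset ι) (P : ι → ℝ) (v : ι → ℂ) :
    ∑ i ∈ S, P i * ∑ j ∈ S, P j * (inner ℝ (v i) (v j) : ℝ) ^ 2 =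
      1 / 2 * ((∑ i ∈ S, P i * ‖v i‖ ^ 2) ^ 2 + ‖∑ i ∈ S, (P i : ℂ) * v i ^ 2‖ ^ 2) := by
  have h1 : ‖∑ i ∈ S, (P i : ℂ) * v i ^ 2‖ ^ 2 =
      ∑ i ∈ S, ∑ j ∈ S, P i * (P j * inner ℝ (v i ^ 2) (v j ^ 2)) := by
    rw [← real_inner_self_eq_norm_sq, sum_inner]
    refine Finset.sum_congr rfl fun i _ => ?_
    rw [inner_sum]
    refine Finset.sum_congr rfl fun j _ => ?_
    rw [← Complex.real_smul, ← Complex.real_smul, real_inner_smul_left, real_inner_smul_right]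
  rw [h1, sq, Finset.sum_mul_sum, ← Finset.sum_add_distrib, Finset.mul_sum]
  refine Finset.sum_congr rfl fun i _ => ?_
  rw [← Finset.sum_add_distrib, Finset.mul_sum, Finset.mul_sum]
  refine Finset.sum_congr rfl fun j _ => ?_
  linear_combination (1 / 2) * P i * P j * two_mul_inner_sq (v i) (v j)

end Moments

/-! ### The capacity -/

section Capacity

variable {S : Finset ℂ} {P : ℂ → ℝ}

/-- Only differences of symbols enter, so they may be recentred at any `m`. With `y = z + √snr • (x
- m)`, each exponent is the log-likelihood ratio at `y` minus `‖y‖² - ‖z‖²`, which does not depend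
on `x'` and leaves the logarithm. -/
lemma logTerm_eq (hP : ∀ x ∈ S, 0 ≤ P x) (hs : ∑ x ∈ S, P x = 1) (m : ℂ) (snr : ℝ) (x z : ℂ) :
    logTerm S P snr x z =
      Real.log (mixture S P (fun x' => √snr • (x' - m)) (z + √snr • (x - m))) -
        (2 * inner ℝ (√snr • (x - m)) z + ‖√snr • (x - m)‖ ^ 2) := by
  set t := √snr with ht
  set w := t • (x - m) with hw
  have h : ∑ x' ∈ S, P x' * exp (-‖(t : ℂ) * (x - x') + z‖ ^ 2 + ‖z‖ ^ 2) =
      mixture S P (fun x' => t • (x' - m)) (z + w) * exp (-(2 * inner ℝ w z + ‖w‖ ^ 2)) := by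
    rw [mixture, Finset.sum_mul]
    refine Finset.sum_congr rfl fun x' _ => ?_
    have h1 : (t : ℂ) * (x - x') + z = (z + w) - t • (x' - m) := by
      rw [hw, Complex.real_smul, Complex.real_smul]; ring
    rw [h1, tilt, mul_assoc, ← Real.exp_add, norm_sub_sq_real (z + w), norm_add_sq_real z w,
      real_inner_comm (z + w), real_inner_comm z w]
    ring_nf
  rw [logTerm, h, Real.log_mul (mixture_pos hP hs _).ne' (Real.exp_pos _).ne', Real.log_exp]
  ring

lemma HasExpGrowth.comp_add_right {f : ℂ → ℝ} (hf : HasExpGrowth f) (w : ℂ) :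
    HasExpGrowth fun z => f (z + w) := by
  obtain ⟨hfc, A, B, hA, hB, hf⟩ := hf
  refine ⟨by fun_prop, A * exp (B * ‖w‖), B, by positivity, hB, fun z => (hf _).trans ?_⟩
  rw [mul_assoc, ← Real.exp_add, ← mul_add, add_comm ‖w‖]
  gcongr
  exact norm_add_le z w

lemma integrable_logTerm (hP : ∀ x ∈ S, 0 ≤ P x) (hs : ∑ x ∈ S, P x = 1) (snr : ℝ) (x : ℂ) :
    Integrable (logTerm S P snr x) noise := by
  rw [funext (logTerm_eq hP hs 0 snr x)]
  exact (((hasExpGrowth_log_mixture hP hs).comp_add_right _).sub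
    (((HasExpGrowth.inner_left _).const_mul 2).add (.const _))).integrable

lemma integral_logTerm (hP : ∀ x ∈ S, 0 ≤ P x) (hs : ∑ x ∈ S, P x = 1) (m : ℂ) (snr : ℝ) (x : ℂ) :
    ∫ z, logTerm S P snr x z ∂noise =
      ∫ y, tilt (√snr • (x - m)) y *
        Real.log (mixture S P (fun x' => √snr • (x' - m)) y) ∂noise - ‖√snr • (x - m)‖ ^ 2 := by
  have h1 := ((hasExpGrowth_log_mixture (v := fun x' => √snr • (x' - m)) hP hs).comp_add_right
    (√snr • (x - m))).integrable
  have h2 := ((HasExpGrowth.inner_left (√snr • (x - m))).const_mul 2).integrable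
  have h3 := (HasExpGrowth.const (‖√snr • (x - m)‖ ^ 2)).integrable
  have h4 : Integrable
      (fun z => 2 * inner ℝ (√snr • (x - m)) z + ‖√snr • (x - m)‖ ^ 2) noise := h2.add h3
  simp only [logTerm_eq hP hs m snr x]
  rw [integral_sub h1 h4, integral_add h2 h3, integral_const_mul, integral_noise_inner,
    integral_noise_const,
    integral_noise_add _ fun y => Real.log (mixture S P (fun x' => √snr • (x' - m)) y)]
  ring

/-- The capacity as a difference of two divergences. -/
lemma capacity_eq (hP : ∀ x ∈ S, 0 ≤ P x) (hs : ∑ x ∈ S, P x = 1) (m : ℂ) {snr : ℝ}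
    (h0 : 0 ≤ snr) :
    capacity S P snr = snr * ∑ x ∈ S, P x * ‖x - m‖ ^ 2 -
      ∫ y, mixture S P (fun x => √snr • (x - m)) y *
        Real.log (mixture S P (fun x => √snr • (x - m)) y) ∂noise := by
  have hn (x : ℂ) : ‖√snr • (x - m)‖ ^ 2 = snr * ‖x - m‖ ^ 2 := by
    rw [norm_smul, mul_pow, Real.norm_eq_abs, sq_abs, Real.sq_sqrt h0]
  have h : ∫ y, mixture S P (fun x => √snr • (x - m)) y *
      Real.log (mixture S P (fun x => √snr • (x - m)) y) ∂noise =
      ∑ x ∈ S, P x * ∫ y, tilt (√snr • (x - m)) y *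
        Real.log (mixture S P (fun x' => √snr • (x' - m)) y) ∂noise := by
    simp only [← integral_const_mul]
    rw [← integral_finsetSum _ fun x _ =>
      (((hasExpGrowth_tilt _).mul (hasExpGrowth_log_mixture hP hs)).const_mul (P x)).integrable]
    refine integral_congr_ae (Eventually.of_forall fun y => ?_)
    simp only [← mul_assoc, ← Finset.sum_mul]
    rfl
  rw [h, capacity, Finset.mul_sum, ← Finset.sum_sub_distrib, ← Finset.sum_neg_distrib]
  refine Finset.sum_congr rfl fun x _ => ?_
  rw [integral_logTerm hP hs m, hn]
  ring

lemma hasLowSNRExpansion_capacity (hP : ∀ x ∈ S, 0 ≤ P x) (hs : ∑ x ∈ S, P x = 1) :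
    HasLowSNRExpansion (capacity S P) (mu2 S P - ‖mu1 S P‖ ^ 2)
      (-(1 / 2) * ((mu2 S P - ‖mu1 S P‖ ^ 2) ^ 2 + ‖mu2' S P - mu1 S P ^ 2‖ ^ 2)) := by
  obtain ⟨K, hK⟩ := exists_abs_integral_mixture_mul_log_sub_le hP hs (sum_smul_centred hs)
  refine IsBigO.trans_isLittleO (g := fun snr : ℝ => snr ^ 3) (IsBigO.of_bound K ?_)
    ((isLittleO_pow_pow (by norm_num)).mono nhdsWithin_le_nhds)
  filter_upwards [Ico_mem_nhdsGE (zero_lt_one' ℝ)] with snr ⟨h0, h1⟩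
  have h := hK (√snr) (Real.sqrt_nonneg _) (Real.sqrt_le_one.2 h1.le)
  have hq := Real.sq_sqrt h0
  rw [show √snr ^ 4 = snr ^ 2 by rw [← hq]; ring_nf; rw [hq],
    show √snr ^ 6 = snr ^ 3 by rw [← hq]; ring_nf; rw [hq],
    sum_sum_inner_sq S P fun x => x - mu1 S P, sum_norm_sq_centred hs, sum_sq_centred hs] at h
  rw [capacity_eq hP hs (mu1 S P) h0, sum_norm_sq_centred hs, Real.norm_eq_abs, Real.norm_eq_abs,
    abs_of_nonneg (by positivity : 0 ≤ snr ^ 3), ← abs_neg]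
  refine le_trans (le_of_eq ?_) h
  congr 1
  ring

end Capacity

/-! ### Uniqueness of the coefficients and the bit-energy-to-noise ratio -/

section Expansion

variable {C : ℝ → ℝ} {c₁ c₂ d₁ d₂ : ℝ}

lemma HasLowSNRExpansion.tendsto_div (h : HasLowSNRExpansion C c₁ c₂) :
    Tendsto (fun s => C s / s) (𝓝[>] 0) (𝓝 c₁) := by
  have h' := (h.mono (nhdsWithin_mono 0 Set.Ioi_subset_Ici_self)).tendsto_div_nhds_zero
  have hid : Tendsto (fun s : ℝ => s) (𝓝[>] 0) (𝓝 0) := tendsto_id.mono_left nhdsWithin_le_nhds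
  have := ((h'.mul hid).add (hid.const_mul c₂)).const_add c₁
  simp only [mul_zero, add_zero] at this
  refine this.congr' ?_
  filter_upwards [self_mem_nhdsWithin] with s hs
  have : s ≠ 0 := (Set.mem_Ioi.1 hs).ne'
  field_simp
  ring

lemma HasLowSNRExpansion.tendsto_sub_div_sq (h : HasLowSNRExpansion C c₁ c₂) :
    Tendsto (fun s => (C s - c₁ * s) / s ^ 2) (𝓝[>] 0) (𝓝 c₂) := by
  have h' := (h.mono (nhdsWithin_mono 0 Set.Ioi_subset_Ici_self)).tendsto_div_nhds_zero
  have := h'.const_add c₂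
  rw [add_zero] at this
  refine this.congr' ?_
  filter_upwards [self_mem_nhdsWithin] with s hs
  have : s ≠ 0 := (Set.mem_Ioi.1 hs).ne'
  field_simp
  ring

/-- Both coefficients are limits along `s → 0⁺`: `c₁` of `C s / s`, then `c₂` of `(C s - c₁ s) /
s²`. -/
lemma HasLowSNRExpansion.unique (h : HasLowSNRExpansion C c₁ c₂)
    (h' : HasLowSNRExpansion C d₁ d₂) : c₁ = d₁ ∧ c₂ = d₂ := by
  obtain rfl := tendsto_nhds_unique h.tendsto_div h'.tendsto_div
  exact ⟨rfl, tendsto_nhds_unique h.tendsto_sub_div_sq h'.tendsto_sub_div_sq⟩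

lemma HasLowSNRExpansion.tendsto_ebN0 (h : HasLowSNRExpansion C c₁ c₂) (hc : c₁ ≠ 0) :
    Tendsto (ebN0 C) (𝓝[>] 0) (𝓝 (Real.log 2 / c₁)) := by
  have := (h.tendsto_div.inv₀ hc).const_mul (Real.log 2)
  rw [← div_eq_mul_inv] at this
  refine this.congr fun s => ?_
  rw [ebN0, Real.logb, Real.log_exp, inv_div, mul_one_div, div_div_eq_mul_div, mul_comm s,
    mul_div_assoc]

end Expansion

end CodedModulation

theorem theorem1 (S : Finset ℂ) (P : ℂ → ℝ)
    (hP_nonneg : ∀ x ∈ S, 0 ≤ P x) (hP_sum : ∑ x ∈ S, P x = 1) :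
    (∀ snr : ℝ, 0 ≤ snr → ∀ x ∈ S,
      MeasureTheory.Integrable (CodedModulation.logTerm S P snr x) CodedModulation.noise) ∧
    (∀ c₁ c₂ : ℝ,
      CodedModulation.HasLowSNRExpansion (CodedModulation.capacity S P) c₁ c₂ ↔
        c₁ = CodedModulation.mu2 S P - ‖CodedModulation.mu1 S P‖ ^ 2 ∧
        c₂ = -(1 / 2) * ((CodedModulation.mu2 S P - ‖CodedModulation.mu1 S P‖ ^ 2) ^ 2 +
          ‖CodedModulation.mu2' S P - CodedModulation.mu1 S P ^ 2‖ ^ 2)) ∧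
    (CodedModulation.mu1 S P = 0 → CodedModulation.mu2 S P = 1 →
      CodedModulation.HasLowSNRExpansion (CodedModulation.capacity S P)
        1 (-(1 / 2) * (1 + ‖CodedModulation.mu2' S P‖ ^ 2)) ∧
      CodedModulation.IsEbN0Lim (CodedModulation.capacity S P) (Real.log 2) ∧
      Filter.Tendsto (CodedModulation.ebN0 (CodedModulation.capacity S P))
        (nhdsWithin 0 (Set.Ioi 0)) (nhds (Real.log 2))) := by
  have hexp := CodedModulation.hasLowSNRExpansion_capacity hP_nonneg hP_sum
  refine ⟨fun snr _ x _ => CodedModulation.integrable_logTerm hP_nonneg hP_sum snr x,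
    fun c₁ c₂ => ⟨fun h => h.unique hexp, ?_⟩, fun h1 h2 => ?_⟩
  · rintro ⟨rfl, rfl⟩
    exact hexp
  · rw [h1, h2] at hexp
    norm_num at hexp
    have hexp' : CodedModulation.HasLowSNRExpansion (CodedModulation.capacity S P)
        1 (-(1 / 2) * (1 + ‖CodedModulation.mu2' S P‖ ^ 2)) := by
      convert hexp using 1
      ring
    refine ⟨hexp', ⟨1, _, hexp', one_ne_zero, by rw [div_one]⟩, ?_⟩
    simpa using hexp'.tendsto_ebN0 one_ne_zero
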